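/- **Setting.** Let $\theta^*=(\{\theta^*_{u,v}\}_{u\ne v},\{\theta^*_u\}_u)$ with $\theta^*_{u,v}=\theta^*_{v,u}$ be the real parameters of an Ising model on $p$ spins, $\mu(\sigma)\propto\exp\big(\sum_{\{u,v\}}\theta^*_{u,v}\sigma_u\sigma_v+\sum_u\theta^*_u\sigma_u\big)$ for $\sigma\in\{-1,1\}^p$, where the first sum runs over unordered pairs of distinct spins. Let $\gamma>0$ satisfy $\sum_{v\ne u}|\theta^*_{u,v}|+|\theta^*_u|\le\gamma$ for all $u\in[p]$. Let $E=\{(u,v):u\ne v,\ \theta^*_{u,v}\ne 0\}$ be the edge set of the interaction graph and $N_u$ the set of neighbours of $u$, and let the maximum degree be at most $D$. Let $\hat\theta_{u,v}$ be coupling estimates with $|\hat\theta_{u,v}-\theta^*_{u,v}|\le\epsilon$ for all $(u,v)\in E$. **Data.** For every set $K\subseteq[p]$ with $|K|\le r:=d+1-(d\bmod 2)$ one is given the empirical mean $\mathbb E_n[\prod_{j\in K}\sigma_j]$ over $n$ independent samples from $\mu$; the samples used for different sets $K$ may be the same or different, with an arbitrary joint law. **Algorithm.** For every $u\in[p]$,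 put $\theta^{(1)}=0$ and, for $t=1,\dots,T$, $\theta^{(t+1)}=\mathcal P_{[-\gamma,\gamma]}\big(\theta^{(t)}-\eta\,\tilde g_u(\theta^{(t)})\big)$, and return $\hat\theta_u=\frac1T\sum_{t=1}^T\theta^{(t)}$. Here $$\tilde g_u(\theta)=-\sum_{k=0}^{d}\frac{(-1)^k}{k!}\sum_{m\in\mathbb N^p,\ \sum_j m_j=k}\frac{k!\,\theta^{m_u}\prod_{j\ne u}\hat\theta_{u,j}^{\,m_j}}{\prod_{j}m_j!}\ \mathbb E_n\Big[\sigma_u^{k+1}\prod_{j\ne u}\sigma_j^{m_j}\Big],$$ where $\hat\theta_{u,j}$ is replaced by $0$ for $j\notin N_u$, and each monomial is reduced by $\sigma_j^2=1$ to a product over a set $K$ with $|K|\le r$, whose empirical mean is the given one. **Theorem (Magnetic field learning).** Let $\epsilon_h>0$ and $\delta\in(0,1)$, and run the algorithm with $$\varepsilon=\frac{\epsilon_h^2e^{-\gamma}}{2(1+\gamma)},\quad L=(1+D\epsilon)e^{2\gamma}+\frac{\varepsilon}{4\gamma},\quad T=\Big\lceil\frac{16\gamma^2L^2}{\varepsilon^2}\Big\rceil,\quad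 \eta=\frac{2\gamma}{L\sqrt T},$$ $$d=\left\lceil\frac{\gamma+\log\frac{8\gamma(1+\gamma)}{\epsilon_h^2}}{W\Big(\frac1{2e}+\frac1{2\gamma e}\log\frac{8\gamma(1+\gamma)}{\epsilon_h^2}\Big)}\right\rceil-1,\qquad n=\left\lceil 32\gamma^2(1+\gamma)^2e^{6\gamma}\,\frac{(d+1)\log(ep)+\log\frac{2(d+1)}{\delta}}{\epsilon_h^4}\right\rceil,$$ where $W$ is the principal branch of the Lambert function. Then, with probability at least $1-\delta$, simultaneously for every $u\in[p]$, $$|\hat\theta_u-\theta^*_u|\le\epsilon_h+\sqrt{8\gamma(1+\gamma)e^{3\gamma}D\epsilon}.$$ -/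

import Mathlib

open MeasureTheory ProbabilityTheory

noncomputable section

/-- The value of a binary spin: `true` is the spin `+1`, `false` is the spin `-1`. -/
def spin (b : Bool) : ℝ := if b then 1 else -1

/-- Spin configurations in `{-1, 1}^p`. -/
abbrev Config (p : ℕ) : Type := Fin p → Bool

/-- The product `∏_{u ∈ K} σ_u`. -/
def monomialValue {p : ℕ} (K : Finset (Fin p)) (σ : Config p) : ℝ := ∏ u ∈ K, spin (σ u)

/-- Parameters of an Ising model on `p` spins: pairwise couplings `θ_{u,v} = θ_{v,u}` for `u ≠ v`
and magnetic fields `θ_u`. The diagonal values `coupling u u` play no role. -/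
structure IsingModel (p : ℕ) where
  coupling : Fin p → Fin p → ℝ
  field : Fin p → ℝ
  symm : ∀ u v, coupling u v = coupling v u

namespace IsingModel

variable {p : ℕ}

/-- The energy, in which every unordered pair `{u, v}` is counted once, so that the
conditional law of `σ_u` given the other spins is governed by
`σ_u (θ_u + ∑_{v ≠ u} θ_{u,v} σ_v)`. -/
def energy (θ : IsingModel p) (σ : Config p) : ℝ :=
  (∑ u : Fin p, ∑ v ∈ Finset.univ.filter (fun v => u < v),
      θ.coupling u v * spin (σ u) * spin (σ v))
    + ∑ u : Fin p, θ.field u * spin (σ u)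

/-- The normalization constant of the Gibbs distribution. -/
def partitionFunction (θ : IsingModel p) : ℝ := ∑ σ : Config p, Real.exp (θ.energy σ)

/-- The Gibbs distribution `μ(σ) ∝ exp (E(σ; θ))`. -/
def gibbs (θ : IsingModel p) : Measure (Config p) :=
  ∑ σ : Config p,
    ENNReal.ofReal (Real.exp (θ.energy σ) / θ.partitionFunction) • Measure.dirac σ

/-- The `ℓ₁`-width of the model is at most `γ`. -/
def WidthLE (θ : IsingModel p) (γ : ℝ) : Prop :=
  ∀ u : Fin p, (∑ v ∈ Finset.univ.erase u, |θ.coupling u v|) + |θ.field u| ≤ γ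

/-- The interaction graph: its edges are the pairs with a nonzero coupling. -/
def graph (θ : IsingModel p) : SimpleGraph (Fin p) where
  Adj u v := u ≠ v ∧ θ.coupling u v ≠ 0
  symm := ⟨fun u v h => ⟨h.1.symm, by rw [θ.symm v u]; exact h.2⟩⟩
  loopless := ⟨fun _ h => h.1 rfl⟩

instance (θ : IsingModel p) : DecidableRel θ.graph.Adj := Classical.decRel _

end IsingModel

/-- The principal real branch of the Lambert function: for `x ≥ -1/e` the unique `w ≥ -1` with
`w * exp w = x`. -/
def lambertW (x : ℝ) : ℝ :=
  Function.invFunOn (fun w : ℝ => w * Real.exp w) (Set.Ici (-1)) x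

/-- The largest order `d + 1 - (d mod 2)` of the statistics that the algorithm may read. -/
def momentOrder (d : ℕ) : ℕ := d + 1 - d % 2

/-- A table of (estimated) statistics: one number for every set of at most `r` spins, standing for
the expectation of the product of these spins. -/
abbrev StatTable (p r : ℕ) : Type := {K : Finset (Fin p) // K.card ≤ r} → ℝ

/-- The statistics `𝔼_n[∏_{u ∈ K} σ_u]`, `|K| ≤ r`, computed from `n` observations. Each of them may
have its own list `x K` of `n` observations. -/
def empiricalStats {p r n : ℕ}
    (x : {K : Finset (Fin p) // K.card ≤ r} → Fin n → Config p) : StatTable p r :=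
  fun K => (1 / (n : ℝ)) * ∑ i : Fin n, monomialValue K.1 (x K i)

/-- Since spins square to one, `σ_u^(k+1) * ∏_{j ≠ u} σ_j^(m j)` is the product of the spins in
this set. -/
def reducedMonomial {p : ℕ} (u : Fin p) (k : ℕ) (m : Fin p → ℕ) : Finset (Fin p) :=
  Finset.univ.filter (fun v => Odd (if v = u then k + 1 else m v))

/-- The sets occurring in the degree-`d` expansion are small enough to be in the table. -/
theorem card_reducedMonomial_le {p d k : ℕ} (u : Fin p) (hk : k ≤ d) (m : Fin p → ℕ)
    (hm : m ∈ Finset.piAntidiag Finset.univ k) :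
    (reducedMonomial u k m).card ≤ momentOrder d := by
  have hsum : ∑ v, m v = k := (Finset.mem_piAntidiag.1 hm).1
  have h2 : ((reducedMonomial u k m).erase u).card ≤ k := by
    rw [Finset.card_eq_sum_ones, ← hsum]
    refine le_trans (Finset.sum_le_sum (fun v hv => ?_))
      (Finset.sum_le_sum_of_subset (Finset.subset_univ _))
    have hv' := Finset.mem_erase.1 hv
    have ho : Odd (m v) := by simpa [reducedMonomial, hv'.1] using hv'.2
    exact ho.pos
  unfold momentOrder
  by_cases hu : u ∈ reducedMonomial u k m
  · have ho : Odd (k + 1) := by simpa [reducedMonomial] using hu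
    have := Finset.card_erase_add_one hu
    rcases ho with ⟨c, hc⟩
    omega
  · rw [Finset.erase_eq_of_notMem hu] at h2
    omega

/-- Look up a statistic; sets that are not in the table cannot be read. -/
def StatTable.read {p r : ℕ} (S : StatTable p r) (K : Finset (Fin p)) : ℝ :=
  if h : K.card ≤ r then S ⟨K, h⟩ else 0

/-- The coupling estimate used at `u`: it is `0` outside the neighbourhood of `u`. -/
def restrictedCoupling {p : ℕ} (G : SimpleGraph (Fin p)) [DecidableRel G.Adj]
    (θhat : Fin p → Fin p → ℝ) (u j : Fin p) : ℝ :=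
  if G.Adj u j then θhat u j else 0

/-- The multinomial coefficient
`k! * θ^(m u) * ∏_{j ≠ u} θhat_{u,j}^(m j) / ∏_j (m j)!`. -/
def multinomialCoeff {p : ℕ} (G : SimpleGraph (Fin p)) [DecidableRel G.Adj]
    (θhat : Fin p → Fin p → ℝ) (u : Fin p) (θ : ℝ) (k : ℕ) (m : Fin p → ℕ) : ℝ :=
  ((Nat.factorial k : ℝ) * θ ^ m u *
      ∏ j ∈ Finset.univ.erase u, restrictedCoupling G θhat u j ^ m j) /
    ∏ j : Fin p, (Nat.factorial (m j) : ℝ)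

/-- The approximation at `θ` of the derivative
`-𝔼[σ_u exp (-σ_u (θ + ∑_{j ∈ N_u} θhat_{u,j} σ_j))]` of the single-variable loss: the exponential
is replaced by its Taylor polynomial of degree `d`, the powers are expanded into monomials, and the
expectation of each monomial is read off the table of statistics. -/
def approxGradient {p : ℕ} (G : SimpleGraph (Fin p)) [DecidableRel G.Adj]
    (θhat : Fin p → Fin p → ℝ) (d : ℕ) (S : StatTable p (momentOrder d)) (u : Fin p) (θ : ℝ) : ℝ :=
  -∑ k ∈ Finset.range (d + 1), ((-1 : ℝ) ^ k / (Nat.factorial k : ℝ)) *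
      ∑ m ∈ Finset.piAntidiag Finset.univ k,
        multinomialCoeff G θhat u θ k m * S.read (reducedMonomial u k m)

/-- The projection of the real line onto `[-γ, γ]`. -/
def clip (γ x : ℝ) : ℝ := max (-γ) (min γ x)

/-- The iterates of projected gradient descent at the node `u`; `fieldIterate … t` is the
`(t + 1)`-st iterate, and the first iterate is `0`. -/
def fieldIterate {p : ℕ} (G : SimpleGraph (Fin p)) [DecidableRel G.Adj]
    (θhat : Fin p → Fin p → ℝ) (d : ℕ) (S : StatTable p (momentOrder d)) (γ η : ℝ) (u : Fin p) :
    ℕ → ℝ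
  | 0 => 0
  | t + 1 =>
      clip γ (fieldIterate G θhat d S γ η u t
        - η * approxGradient G θhat d S u (fieldIterate G θhat d S γ η u t))

/-- The output of the algorithm at the node `u`: the average of the first `T` iterates. -/
def fieldEstimate {p : ℕ} (G : SimpleGraph (Fin p)) [DecidableRel G.Adj]
    (θhat : Fin p → Fin p → ℝ) (d : ℕ) (S : StatTable p (momentOrder d)) (γ η : ℝ) (T : ℕ)
    (u : Fin p) : ℝ :=
  (1 / (T : ℝ)) * ∑ t ∈ Finset.range T, fieldIterate G θhat d S γ η u t

end

open MeasureTheory ProbabilityTheory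

noncomputable section

/-! Fix a node `u`, let `H` be the local field there and put `Δ = t - θ_u`. Given the other spins,
`σ_u` has weight proportional to `exp (σ_u H)`. The factor `exp (-σ_u (H + Δ))` in the loss cancels
this weight, so with the true couplings the derivative of the loss is exactly `c * sinh Δ`, where `c
= 𝔼[1 / cosh H] ≥ 1 / cosh γ` (`mean_spin_mul_exp`, `one_le_cosh_mul_curvature`). Since `x * sinh x
≥ x ^ 2`, the squared distance to the true field is at most `cosh γ` times the product of derivative
and displacement.

The algorithm sees this derivative up to three errors, from sampling, from the couplings (total `ℓ₁`
error `x = D * εc` at a node) and from truncating the exponential; `abs_approxGradient_sub_le`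
bounds their sum. The regret bound for projected descent holds for any bounded sequence of
gradients, so convexity of the approximate loss is not needed. Together with Cauchy-Schwarz it
bounds the squared error of the averaged iterate by `εh ^ 2 + 8γ(1 + γ)exp(3γ)x`.

Chance enters only through Hoeffding's inequality for each statistic and a union bound over the
table, so the joint law of different statistics is irrelevant. Estimate and truth both lie in `[-γ,
γ]`, so a claimed bound of `2γ` or more is trivial; otherwise `εh < 2γ` and `x ≤ 1/8`, which the
constants require. -/

/-! ### Truncations of the exponential series -/

/-- The sum of the first `n` terms of the exponential series. -/
def expTrunc (n : ℕ) (y : ℝ) : ℝ := ∑ k ∈ Finset.range n, y ^ k / (k.factorial : ℝ)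

theorem expTrunc_le_exp (n : ℕ) {y : ℝ} (hy : 0 ≤ y) : expTrunc n y ≤ Real.exp y :=
  Real.sum_le_exp_of_nonneg hy n

theorem abs_exp_sub_expTrunc_le {n : ℕ} {y : ℝ} (h : |y| / (n + 1 : ℝ) ≤ 1 / 2) :
    |Real.exp y - expTrunc n y| ≤ |y| ^ n / n.factorial * 2 := by
  have h' : ‖(y : ℂ)‖ / ((n.succ : ℕ) : ℝ) ≤ 1 / 2 := by simpa using h
  have := Complex.exp_bound' h'
  rw [Complex.norm_real, Real.norm_eq_abs] at this
  refine le_trans (le_of_eq ?_) this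
  rw [← Real.norm_eq_abs, ← Complex.norm_real]
  congr 1
  simp [expTrunc]

/-- The derivative of a truncation is a shorter truncation, at most `exp ρ` in absolute value on
`[-ρ, ρ]`. With this the error of the couplings is measured on the polynomial itself. -/
theorem abs_expTrunc_sub_expTrunc_le (n : ℕ) {a b ρ : ℝ} (ha : |a| ≤ ρ) (hb : |b| ≤ ρ) :
    |expTrunc n a - expTrunc n b| ≤ |a - b| * Real.exp ρ := by
  have hρ : 0 ≤ ρ := (abs_nonneg a).trans ha
  have key : ∀ n, |expTrunc (n + 1) a - expTrunc (n + 1) b| ≤ |a - b| * Real.exp ρ := by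
    intro n
    have h1 : ∀ k : ℕ, |a ^ (k + 1) / ((k + 1).factorial : ℝ) - b ^ (k + 1) / ((k + 1).factorial : ℝ)|
        ≤ |a - b| * (ρ ^ k / (k.factorial : ℝ)) := by
      intro k
      have hk : (0 : ℝ) < ((k + 1).factorial : ℝ) := by positivity
      rw [← sub_div, abs_div, abs_of_pos hk, div_le_iff₀ hk]
      calc |a ^ (k + 1) - b ^ (k + 1)|
          ≤ |a - b| * ((k + 1 : ℕ) : ℝ) * max |a| |b| ^ k := abs_pow_sub_pow_le a b (k + 1)
        _ ≤ |a - b| * ((k + 1 : ℕ) : ℝ) * ρ ^ k := by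
          gcongr
          exact max_le ha hb
        _ = |a - b| * (ρ ^ k / (k.factorial : ℝ)) * ((k + 1).factorial : ℝ) := by
          rw [Nat.factorial_succ]
          push_cast
          field_simp
    unfold expTrunc
    rw [← Finset.sum_sub_distrib, Finset.sum_range_succ']
    simp only [pow_zero, sub_self, add_zero]
    refine (Finset.abs_sum_le_sum_abs _ _).trans ((Finset.sum_le_sum fun k _ => h1 k).trans ?_)
    rw [← Finset.mul_sum]
    gcongr
    exact Real.sum_le_exp_of_nonneg hρ n
  cases n with
  | zero =>
    simp only [expTrunc, Finset.range_zero, Finset.sum_empty, sub_self, abs_zero]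
    positivity
  | succ n => exact key n

/-! ### The Lambert function and the choice of the degree -/

theorem lambertW_pos_and_mul_exp {y : ℝ} (hy : 0 < y) :
    0 < lambertW y ∧ lambertW y * Real.exp (lambertW y) = y := by
  have hex : ∃ w ∈ Set.Ici (-1 : ℝ), (fun w : ℝ => w * Real.exp w) w = y := by
    have hc : ContinuousOn (fun w : ℝ => w * Real.exp w) (Set.Icc 0 y) := by fun_prop
    have hmem : y ∈ Set.Icc ((fun w : ℝ => w * Real.exp w) 0) ((fun w : ℝ => w * Real.exp w) y) := by
      refine ⟨by simpa using hy.le, ?_⟩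
      have : 1 ≤ Real.exp y := Real.one_le_exp hy.le
      simpa using le_mul_of_one_le_right hy.le this
    -- Existence of one solution suffices: any value picked by `invFunOn` solves the equation, and
    -- the equation forces its sign.
    obtain ⟨w, hw, hwy⟩ := intermediate_value_Icc hy.le hc hmem
    exact ⟨w, by have := hw.1; simp only [Set.mem_Ici]; linarith, hwy⟩
  have heq : lambertW y * Real.exp (lambertW y) = y := Function.invFunOn_eq hex
  refine ⟨?_, heq⟩
  by_contra h
  have := mul_nonpos_of_nonpos_of_nonneg (not_lt.1 h) (Real.exp_pos (lambertW y)).le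
  linarith

/-- Stirling with `√(2πn) ≥ 2`; the gained factor `2` absorbs the one in the tail bound of the
exponential series. -/
theorem two_mul_pow_le_factorial {n : ℕ} (hn : 1 ≤ n) :
    2 * ((n : ℝ) / Real.exp 1) ^ n ≤ n.factorial := by
  refine le_trans ?_ (Stirling.le_factorial_stirling n)
  gcongr
  refine Real.le_sqrt_of_sq_le ?_
  have h1 : (1 : ℝ) ≤ n := by exact_mod_cast hn
  nlinarith [Real.pi_gt_three]

/-- The Lambert function gives the number of terms after which the exponential series, on an
interval of radius `a`, has an error of at most `exp (-b)`. -/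
theorem pow_div_factorial_le_of_lambertW {a b : ℝ} (ha : 0 < a) (hb : 0 < b) {n : ℕ} (hn : 1 ≤ n)
    (h : b / lambertW (b / (a * Real.exp 1)) ≤ n) :
    a * Real.exp 1 ≤ n ∧ a ^ n / n.factorial * 2 ≤ Real.exp (-b) := by
  have hae : 0 < a * Real.exp 1 := by positivity
  obtain ⟨hW, hWe⟩ := lambertW_pos_and_mul_exp (div_pos hb hae)
  set W := lambertW (b / (a * Real.exp 1))
  -- The defining equation of `W` makes the threshold `b / W` serve twice: it yields `a * e / n ≤
  -- exp (-W)` and `b ≤ n * W`.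
  have hbW : b / W = a * Real.exp 1 * Real.exp W := by
    rw [div_eq_iff hW.ne', mul_assoc, mul_comm _ W, hWe]
    field_simp
  rw [hbW] at h
  have hn0 : (0 : ℝ) < n := by exact_mod_cast hn
  have hbn : b ≤ n * W := by
    rw [← hbW, div_le_iff₀ hW] at h
    exact h
  refine ⟨le_trans (le_mul_of_one_le_right hae.le (Real.one_le_exp hW.le)) h, ?_⟩
  have hf := two_mul_pow_le_factorial hn
  have hp : 0 < ((n : ℝ) / Real.exp 1) ^ n := by positivity
  calc a ^ n / n.factorial * 2 ≤ a ^ n / (2 * ((n : ℝ) / Real.exp 1) ^ n) * 2 := by gcongr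
    _ = (a * Real.exp 1 / n) ^ n := by
      rw [div_pow, div_pow, mul_pow]
      field_simp
    _ ≤ (Real.exp (-W)) ^ n := by
      gcongr
      rw [div_le_iff₀ hn0, Real.exp_neg, inv_mul_eq_div, le_div_iff₀ (Real.exp_pos _)]
      exact h
    _ ≤ Real.exp (-b) := by
      rw [← Real.exp_nat_mul]
      gcongr
      linarith

/-! ### Spins and expectations under the Gibbs distribution -/

theorem abs_spin (b : Bool) : |spin b| = 1 := by cases b <;> simp [spin]

theorem spin_mul_self (b : Bool) : spin b * spin b = 1 := by cases b <;> simp [spin]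

theorem spin_not (b : Bool) : spin (!b) = -spin b := by cases b <;> simp [spin]

theorem abs_monomialValue {p : ℕ} (K : Finset (Fin p)) (σ : Config p) :
    |monomialValue K σ| = 1 := by
  simp [monomialValue, Finset.abs_prod, abs_spin]

/-- The configuration in which the spin at `u` is reversed. -/
def flipSpin {p : ℕ} (u : Fin p) (σ : Config p) : Config p := Function.update σ u (!σ u)

theorem flipSpin_involutive {p : ℕ} (u : Fin p) : Function.Involutive (flipSpin u) := by
  intro σ
  simp [flipSpin]

theorem flipSpin_self {p : ℕ} (u : Fin p) (σ : Config p) : flipSpin u σ u = !σ u := by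
  simp [flipSpin]

theorem flipSpin_of_ne {p : ℕ} {u v : Fin p} (h : v ≠ u) (σ : Config p) :
    flipSpin u σ v = σ v := by
  simp [flipSpin, h]

/-- A weight that does not depend on the spin at `u` averages a function of that spin. -/
theorem sum_mul_of_flipSpin_invariant {p : ℕ} (u : Fin p) (F : Config p → ℝ)
    (hF : ∀ σ, F (flipSpin u σ) = F σ) (φ : Bool → ℝ) :
    ∑ σ, F σ * φ (σ u) = (∑ σ, F σ) * ((φ true + φ false) / 2) := by
  have h1 : ∑ σ, F σ * φ (σ u) = ∑ σ, F σ * φ (!σ u) := by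
    rw [← Equiv.sum_comp (flipSpin_involutive u).toPerm (fun σ => F σ * φ (σ u))]
    simp [hF, flipSpin_self]
  have h2 : ∑ σ, F σ * φ (σ u) + ∑ σ, F σ * φ (!σ u) = (∑ σ, F σ) * (φ true + φ false) := by
    rw [← Finset.sum_add_distrib, Finset.sum_mul]
    refine Finset.sum_congr rfl fun σ _ => ?_
    cases σ u <;> simp <;> ring
  linarith

/-! ### The Gibbs mean and the conditional structure at one spin. -/

namespace IsingModel

variable {p : ℕ}

theorem partitionFunction_pos (θ : IsingModel p) : 0 < θ.partitionFunction :=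
  Finset.sum_pos (fun _ _ => Real.exp_pos _) Finset.univ_nonempty

/-- The expectation of a function under the Gibbs distribution, as a finite sum. -/
def mean (θ : IsingModel p) (f : Config p → ℝ) : ℝ :=
  ∑ σ, Real.exp (θ.energy σ) / θ.partitionFunction * f σ

theorem integral_gibbs (θ : IsingModel p) (f : Config p → ℝ) : ∫ σ, f σ ∂θ.gibbs = θ.mean f := by
  unfold gibbs mean
  rw [integral_finsetSum_measure (fun σ _ => (Integrable.of_finite).smul_measure (by simp))]
  refine Finset.sum_congr rfl fun σ _ => ?_
  rw [integral_smul_measure, integral_dirac, ENNReal.toReal_ofReal, smul_eq_mul]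
  have := θ.partitionFunction_pos
  positivity

theorem mean_const (θ : IsingModel p) (c : ℝ) : θ.mean (fun _ => c) = c := by
  unfold mean
  rw [← Finset.sum_mul, ← Finset.sum_div]
  change θ.partitionFunction / θ.partitionFunction * c = c
  rw [div_self θ.partitionFunction_pos.ne', one_mul]

theorem mean_sub (θ : IsingModel p) (f g : Config p → ℝ) :
    θ.mean (fun σ => f σ - g σ) = θ.mean f - θ.mean g := by
  simp [mean, mul_sub, Finset.sum_sub_distrib]

theorem mean_mono (θ : IsingModel p) {f g : Config p → ℝ} (h : ∀ σ, f σ ≤ g σ) :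
    θ.mean f ≤ θ.mean g := by
  have := θ.partitionFunction_pos
  unfold mean
  gcongr with σ
  exact h σ

theorem abs_mean_le (θ : IsingModel p) {f : Config p → ℝ} {c : ℝ} (h : ∀ σ, |f σ| ≤ c) :
    |θ.mean f| ≤ c := by
  rw [abs_le]
  constructor
  · rw [← θ.mean_const (-c)]
    exact θ.mean_mono fun σ => (abs_le.1 (h σ)).1
  · rw [← θ.mean_const c]
    exact θ.mean_mono fun σ => (abs_le.1 (h σ)).2

/-- The field `θ_u + ∑_{v ≠ u} θ_{u,v} σ_v` that acts on the spin at `u`. -/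
def localField (θ : IsingModel p) (u : Fin p) (σ : Config p) : ℝ :=
  θ.field u + ∑ v ∈ Finset.univ.erase u, θ.coupling u v * spin (σ v)

theorem abs_localField_le (θ : IsingModel p) {γ : ℝ} (h : θ.WidthLE γ) (u : Fin p)
    (σ : Config p) : |θ.localField u σ| ≤ γ := by
  refine le_trans (abs_add_le _ _) ?_
  have h1 : |∑ v ∈ Finset.univ.erase u, θ.coupling u v * spin (σ v)|
      ≤ ∑ v ∈ Finset.univ.erase u, |θ.coupling u v| := by
    refine (Finset.abs_sum_le_sum_abs _ _).trans (le_of_eq ?_)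
    simp [abs_mul, abs_spin]
  linarith [h u]

theorem localField_flipSpin (θ : IsingModel p) (u : Fin p) (σ : Config p) :
    θ.localField u (flipSpin u σ) = θ.localField u σ := by
  unfold localField
  congr 1
  refine Finset.sum_congr rfl fun v hv => ?_
  rw [flipSpin_of_ne (Finset.ne_of_mem_erase hv)]

theorem energy_flipSpin (θ : IsingModel p) (u : Fin p) (σ : Config p) :
    θ.energy (flipSpin u σ) = θ.energy σ - 2 * (spin (σ u) * θ.localField u σ) := by
  have hs : ∀ v, spin (flipSpin u σ v) = if v = u then -spin (σ u) else spin (σ v) := by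
    intro v
    split_ifs with h
    · rw [h, flipSpin_self, spin_not]
    · rw [flipSpin_of_ne h]
  have hfield : ∑ v, θ.field v * spin (flipSpin u σ v)
      = (∑ v, θ.field v * spin (σ v)) - 2 * (spin (σ u) * θ.field u) := by
    rw [eq_sub_iff_add_eq, add_comm, ← eq_sub_iff_add_eq, ← Finset.sum_sub_distrib]
    rw [Finset.sum_eq_single u]
    · simp [hs]; ring
    · intro v _ hv
      simp [hs, hv]
    · simp
  have hpair : (∑ a : Fin p, ∑ b ∈ Finset.univ.filter (fun b => a < b),
        θ.coupling a b * spin (σ a) * spin (σ b))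
      - (∑ a : Fin p, ∑ b ∈ Finset.univ.filter (fun b => a < b),
        θ.coupling a b * spin (flipSpin u σ a) * spin (flipSpin u σ b))
      = 2 * (spin (σ u) * ∑ v ∈ Finset.univ.erase u, θ.coupling u v * spin (σ v)) := by
    -- Pairs that avoid `u` cancel. The energy orders its pairs, so the neighbours above `u` and
    -- those below it come from different slots.
    have hterm : ∀ a b : Fin p,
        (if a < b then θ.coupling a b * spin (σ a) * spin (σ b) else 0)
          - (if a < b then θ.coupling a b * spin (flipSpin u σ a) * spin (flipSpin u σ b) else 0)
        = (if a = u then (if u < b then 2 * (spin (σ u) * (θ.coupling u b * spin (σ b))) else 0)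
            else 0)
          + (if b = u then (if a < u then 2 * (spin (σ u) * (θ.coupling u a * spin (σ a))) else 0)
            else 0) := by
      intro a b
      rw [hs, hs]
      by_cases ha : a = u
      · subst ha
        by_cases hb : b = a
        · subst hb; simp
        · by_cases hab : a < b <;> simp [hb, hab]; ring
      · by_cases hb : b = u
        · subst hb
          by_cases hab : a < b <;> simp [ha, hab]
          rw [θ.symm b a]; ring
        · simp [ha, hb]
    simp only [Finset.sum_filter]
    rw [← Finset.sum_sub_distrib]
    simp only [← Finset.sum_sub_distrib, hterm, Finset.sum_add_distrib]
    rw [Finset.sum_comm (f := fun a b => if a = u then _ else _)]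
    simp only [Finset.sum_ite_eq', Finset.mem_univ, if_true]
    rw [← Finset.sum_add_distrib, Finset.mul_sum, Finset.mul_sum,
      ← Finset.add_sum_erase _ _ (Finset.mem_univ u)]
    simp only [lt_irrefl, if_false, add_zero, zero_add]
    refine Finset.sum_congr rfl fun v hv => ?_
    rcases lt_or_gt_of_ne (Finset.ne_of_mem_erase hv) with h | h
    · simp [h, h.not_gt]
    · simp [h, h.not_gt]
  unfold energy localField
  rw [hfield]
  linarith

/-- The part of the energy that does not depend on the spin at `u`. -/
def restEnergy (θ : IsingModel p) (u : Fin p) (σ : Config p) : ℝ :=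
  θ.energy σ - spin (σ u) * θ.localField u σ

theorem restEnergy_flipSpin (θ : IsingModel p) (u : Fin p) (σ : Config p) :
    θ.restEnergy u (flipSpin u σ) = θ.restEnergy u σ := by
  unfold restEnergy
  rw [energy_flipSpin, localField_flipSpin, flipSpin_self, spin_not]
  ring

/-- The expectation `𝔼[1 / cosh H_u]`, where `H_u` is the local field at `u`. -/
def curvature (θ : IsingModel p) (u : Fin p) : ℝ :=
  (∑ σ, Real.exp (θ.restEnergy u σ)) / θ.partitionFunction

theorem curvature_pos (θ : IsingModel p) (u : Fin p) : 0 < θ.curvature u :=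
  div_pos (Finset.sum_pos (fun _ _ => Real.exp_pos _) Finset.univ_nonempty) θ.partitionFunction_pos

theorem one_le_cosh_mul_curvature (θ : IsingModel p) {γ : ℝ} (hγ : 0 ≤ γ) (h : θ.WidthLE γ)
    (u : Fin p) : 1 ≤ Real.cosh γ * θ.curvature u := by
  unfold curvature
  rw [← mul_div_assoc, le_div_iff₀ θ.partitionFunction_pos, one_mul]
  -- Averaging the sum over `σ` with its reindexing by the flip at `u` turns `exp (σ_u H)` into
  -- `cosh H`.
  have hZ : θ.partitionFunction
      = ∑ σ, Real.exp (θ.restEnergy u σ) * Real.cosh (θ.localField u σ) := by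
    have hflip : θ.partitionFunction = ∑ σ, Real.exp (θ.energy (flipSpin u σ)) :=
      (Equiv.sum_comp (flipSpin_involutive u).toPerm (fun σ => Real.exp (θ.energy σ))).symm
    have h2 : θ.partitionFunction + θ.partitionFunction
        = 2 * ∑ σ, Real.exp (θ.restEnergy u σ) * Real.cosh (θ.localField u σ) := by
      nth_rewrite 2 [hflip]
      unfold partitionFunction
      rw [← Finset.sum_add_distrib, Finset.mul_sum]
      refine Finset.sum_congr rfl fun σ _ => ?_
      rw [energy_flipSpin, Real.cosh_eq]
      have e1 : Real.exp (θ.energy σ)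
          = Real.exp (θ.restEnergy u σ) * Real.exp (spin (σ u) * θ.localField u σ) := by
        rw [← Real.exp_add]; congr 1; unfold restEnergy; ring
      have e2 : Real.exp (θ.energy σ - 2 * (spin (σ u) * θ.localField u σ))
          = Real.exp (θ.restEnergy u σ) * Real.exp (-(spin (σ u) * θ.localField u σ)) := by
        rw [← Real.exp_add]; congr 1; unfold restEnergy; ring
      rw [e1, e2]
      cases σ u <;> simp [spin] <;> ring
    linarith
  rw [hZ, Finset.mul_sum]
  refine Finset.sum_le_sum fun σ _ => ?_
  rw [mul_comm]
  gcongr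
  rw [Real.cosh_le_cosh, abs_of_nonneg hγ]
  exact θ.abs_localField_le h u σ

/-- With the true couplings, the derivative of the single-variable loss at distance `Δ` from the
true field is a multiple of `sinh Δ`. -/
theorem mean_spin_mul_exp (θ : IsingModel p) (u : Fin p) (Δ : ℝ) :
    θ.mean (fun σ => spin (σ u) * Real.exp (-(spin (σ u) * (θ.localField u σ + Δ))))
      = -(θ.curvature u * Real.sinh Δ) := by
  have h1 : θ.mean (fun σ => spin (σ u) * Real.exp (-(spin (σ u) * (θ.localField u σ + Δ))))
      = (∑ σ, Real.exp (θ.restEnergy u σ) *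
          (fun b => spin b * Real.exp (-(spin b * Δ))) (σ u)) / θ.partitionFunction := by
    unfold mean
    rw [Finset.sum_div]
    refine Finset.sum_congr rfl fun σ _ => ?_
    -- The local field cancels; the remaining weight does not see `σ_u`, which therefore averages as
    -- a fair sign.
    have e : Real.exp (θ.energy σ) * Real.exp (-(spin (σ u) * (θ.localField u σ + Δ)))
        = Real.exp (θ.restEnergy u σ) * Real.exp (-(spin (σ u) * Δ)) := by
      rw [← Real.exp_add, ← Real.exp_add]; congr 1; unfold restEnergy; ring
    simp only
    rw [div_mul_eq_mul_div]
    congr 1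
    linear_combination spin (σ u) * e
  rw [h1, sum_mul_of_flipSpin_invariant u (fun σ => Real.exp (θ.restEnergy u σ))
    (fun σ => by rw [restEnergy_flipSpin]) (fun b => spin b * Real.exp (-(spin b * Δ)))]
  unfold curvature
  rw [Real.sinh_eq]
  simp [spin]
  ring

end IsingModel

/-! ### The approximate gradient -/

theorem spin_pow (b : Bool) (n : ℕ) : spin b ^ n = if Odd n then spin b else 1 := by
  split_ifs with h
  · obtain ⟨c, rfl⟩ := h
    rw [pow_succ, pow_mul, sq, spin_mul_self, one_pow, one_mul]
  · obtain ⟨c, rfl⟩ := Nat.not_odd_iff_even.1 h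
    rw [← two_mul, pow_mul, sq, spin_mul_self, one_pow]

theorem monomialValue_reducedMonomial {p : ℕ} (u : Fin p) (k : ℕ) (m : Fin p → ℕ)
    (σ : Config p) : monomialValue (reducedMonomial u k m) σ
      = spin (σ u) ^ (k + 1) * ∏ j ∈ Finset.univ.erase u, spin (σ j) ^ m j := by
  unfold monomialValue reducedMonomial
  rw [Finset.prod_filter]
  simp only [← spin_pow]
  rw [← Finset.mul_prod_erase _ _ (Finset.mem_univ u), if_pos rfl]
  congr 1
  refine Finset.prod_congr rfl fun j hj => ?_
  rw [if_neg (Finset.ne_of_mem_erase hj)]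

section Gradient

variable {p : ℕ} (G : SimpleGraph (Fin p)) [DecidableRel G.Adj] (θhat : Fin p → Fin p → ℝ)
  (d : ℕ) (u : Fin p) (t : ℝ)

theorem multinomialCoeff_eq {k : ℕ} {m : Fin p → ℕ} (hm : m ∈ Finset.piAntidiag Finset.univ k) :
    multinomialCoeff G θhat u t k m = Nat.multinomial Finset.univ m *
      (t ^ m u * ∏ j ∈ Finset.univ.erase u, restrictedCoupling G θhat u j ^ m j) := by
  have hsum : ∑ v, m v = k := (Finset.mem_piAntidiag.1 hm).1
  have hspec := Nat.multinomial_spec Finset.univ m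
  rw [hsum] at hspec
  unfold multinomialCoeff
  rw [← hspec, div_eq_iff (Finset.prod_ne_zero_iff.2 fun j _ => by positivity)]
  push_cast
  ring

/-- The multinomial theorem for `b` with its value at `u` replaced by `a`. -/
theorem sum_multinomial_mul (k : ℕ) (a : ℝ) (b : Fin p → ℝ) :
    ∑ m ∈ Finset.piAntidiag Finset.univ k, (Nat.multinomial Finset.univ m : ℝ) *
      (a ^ m u * ∏ j ∈ Finset.univ.erase u, b j ^ m j)
      = (a + ∑ j ∈ Finset.univ.erase u, b j) ^ k := by
  have h := Finset.sum_pow_eq_sum_piAntidiag Finset.univ (Function.update b u a) k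
  rw [← Finset.add_sum_erase _ _ (Finset.mem_univ u), Function.update_self] at h
  rw [show ∑ j ∈ Finset.univ.erase u, b j = ∑ j ∈ Finset.univ.erase u, Function.update b u a j from
    Finset.sum_congr rfl fun j hj => by rw [Function.update_of_ne (Finset.ne_of_mem_erase hj)], h]
  refine Finset.sum_congr rfl fun m _ => ?_
  rw [← Finset.mul_prod_erase _ _ (Finset.mem_univ u), Function.update_self]
  congr 2
  refine Finset.prod_congr rfl fun j hj => ?_
  rw [Function.update_of_ne (Finset.ne_of_mem_erase hj)]

/-- The field `t + ∑_{j ≠ u} θhat_{u,j} σ_j` that acts on the spin at `u` in the estimated model. -/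
def estimatedField (σ : Config p) : ℝ :=
  t + ∑ j ∈ Finset.univ.erase u, restrictedCoupling G θhat u j * spin (σ j)

/-- The `ℓ₁`-norm of the coefficients of the estimated field. -/
def estimatedWidth : ℝ :=
  |t| + ∑ j ∈ Finset.univ.erase u, |restrictedCoupling G θhat u j|

theorem estimatedWidth_nonneg : 0 ≤ estimatedWidth G θhat u t := by
  unfold estimatedWidth
  positivity

theorem sum_abs_multinomialCoeff (k : ℕ) :
    ∑ m ∈ Finset.piAntidiag Finset.univ k, |multinomialCoeff G θhat u t k m|
      = estimatedWidth G θhat u t ^ k := by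
  unfold estimatedWidth
  rw [← sum_multinomial_mul]
  refine Finset.sum_congr rfl fun m hm => ?_
  rw [multinomialCoeff_eq G θhat u t hm, abs_mul, abs_mul, Finset.abs_prod, Nat.abs_cast, abs_pow]
  simp only [abs_pow]

theorem sum_multinomialCoeff_mul_monomialValue (k : ℕ) (σ : Config p) :
    ∑ m ∈ Finset.piAntidiag Finset.univ k,
        multinomialCoeff G θhat u t k m * monomialValue (reducedMonomial u k m) σ
      = spin (σ u) ^ (k + 1) * estimatedField G θhat u t σ ^ k := by
  unfold estimatedField
  rw [← sum_multinomial_mul, Finset.mul_sum]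
  refine Finset.sum_congr rfl fun m hm => ?_
  rw [multinomialCoeff_eq G θhat u t hm, monomialValue_reducedMonomial]
  simp only [mul_pow, Finset.prod_mul_distrib]
  ring

/-- The approximate gradient is a linear function of the statistics whose coefficients have a
bounded `ℓ₁`-norm. -/
theorem abs_sum_multinomialCoeff_le {f : Finset (Fin p) → ℝ} {s ρ : ℝ} (hs : 0 ≤ s)
    (hf : ∀ K, K.card ≤ momentOrder d → |f K| ≤ s) (hρ : estimatedWidth G θhat u t ≤ ρ) :
    |∑ k ∈ Finset.range (d + 1), ((-1 : ℝ) ^ k / (Nat.factorial k : ℝ)) *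
      ∑ m ∈ Finset.piAntidiag Finset.univ k,
        multinomialCoeff G θhat u t k m * f (reducedMonomial u k m)| ≤ s * Real.exp ρ := by
  have hk : ∀ k ∈ Finset.range (d + 1), |((-1 : ℝ) ^ k / (Nat.factorial k : ℝ)) *
      ∑ m ∈ Finset.piAntidiag Finset.univ k,
        multinomialCoeff G θhat u t k m * f (reducedMonomial u k m)|
      ≤ s * (estimatedWidth G θhat u t ^ k / (Nat.factorial k : ℝ)) := by
    intro k hk
    have hkd : k ≤ d := Nat.lt_succ_iff.1 (Finset.mem_range.1 hk)
    have h1 : |∑ m ∈ Finset.piAntidiag Finset.univ k,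
        multinomialCoeff G θhat u t k m * f (reducedMonomial u k m)|
        ≤ s * estimatedWidth G θhat u t ^ k := by
      rw [← sum_abs_multinomialCoeff, Finset.mul_sum]
      refine (Finset.abs_sum_le_sum_abs _ _).trans (Finset.sum_le_sum fun m hm => ?_)
      rw [abs_mul, mul_comm]
      gcongr
      exact hf _ (card_reducedMonomial_le u hkd m hm)
    rw [abs_mul, abs_div, abs_pow, abs_neg, abs_one, one_pow, Nat.abs_cast, one_div_mul_eq_div,
      ← mul_div_assoc]
    gcongr
  refine (Finset.abs_sum_le_sum_abs _ _).trans ((Finset.sum_le_sum hk).trans ?_)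
  rw [← Finset.mul_sum]
  gcongr
  exact (expTrunc_le_exp _ (estimatedWidth_nonneg G θhat u t)).trans (Real.exp_le_exp.2 hρ)

theorem StatTable.read_of_card_le {r : ℕ} (S : StatTable p r) {K : Finset (Fin p)}
    (h : K.card ≤ r) : S.read K = S ⟨K, h⟩ := dif_pos h

/-- This is the gradient bound that the regret estimate needs; it uses no accuracy of the
statistics. -/
theorem abs_approxGradient_le {S : StatTable p (momentOrder d)} (hS : ∀ K, |S K| ≤ 1) {ρ : ℝ}
    (hρ : estimatedWidth G θhat u t ≤ ρ) : |approxGradient G θhat d S u t| ≤ Real.exp ρ := by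
  have := abs_sum_multinomialCoeff_le G θhat d u t (f := S.read) zero_le_one
    (fun K hK => by rw [S.read_of_card_le hK]; exact hS _) hρ
  rw [one_mul] at this
  rw [approxGradient, abs_neg]
  exact this

/-- With exact statistics the approximate gradient is the expectation of the truncated
exponential series. -/
theorem sum_multinomialCoeff_mul_mean (θ : IsingModel p) :
    ∑ k ∈ Finset.range (d + 1), ((-1 : ℝ) ^ k / (Nat.factorial k : ℝ)) *
      ∑ m ∈ Finset.piAntidiag Finset.univ k,
        multinomialCoeff G θhat u t k m * θ.mean (monomialValue (reducedMonomial u k m))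
      = θ.mean (fun σ => spin (σ u) *
          expTrunc (d + 1) (-(spin (σ u) * estimatedField G θhat u t σ))) := by
  have h1 : ∀ k, ∑ m ∈ Finset.piAntidiag Finset.univ k,
        multinomialCoeff G θhat u t k m * θ.mean (monomialValue (reducedMonomial u k m))
      = θ.mean (fun σ => spin (σ u) ^ (k + 1) * estimatedField G θhat u t σ ^ k) := by
    intro k
    unfold IsingModel.mean
    simp only [← sum_multinomialCoeff_mul_monomialValue, Finset.mul_sum]
    rw [Finset.sum_comm]
    refine Finset.sum_congr rfl fun σ _ => Finset.sum_congr rfl fun m _ => ?_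
    ring
  simp only [h1]
  unfold IsingModel.mean expTrunc
  simp only [Finset.mul_sum]
  rw [Finset.sum_comm]
  refine Finset.sum_congr rfl fun σ _ => Finset.sum_congr rfl fun k _ => ?_
  rw [neg_pow (spin (σ u) * _), mul_pow (spin (σ u))]
  ring

theorem abs_estimatedField_le (σ : Config p) :
    |estimatedField G θhat u t σ| ≤ estimatedWidth G θhat u t := by
  refine (abs_add_le _ _).trans ?_
  unfold estimatedWidth
  gcongr
  refine (Finset.abs_sum_le_sum_abs _ _).trans (le_of_eq ?_)
  simp [abs_mul, abs_spin]

variable {G θhat d u t}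

/-- The approximate gradient agrees with the derivative of the exact loss up to the statistical
error, the error of the couplings, and the truncation error. -/
theorem abs_approxGradient_sub_le (θ : IsingModel p) {γ x s : ℝ} (hγ : 0 < γ)
    (hwidth : θ.WidthLE γ) (ht : |t| ≤ γ) (hx : 0 ≤ x) (hs : 0 ≤ s)
    (hcoupling : ∑ j ∈ Finset.univ.erase u, |restrictedCoupling G θhat u j - θ.coupling u j| ≤ x)
    {S : StatTable p (momentOrder d)} (hS : ∀ K, |S K - θ.mean (monomialValue K.1)| ≤ s)
    (hd : 2 * γ * Real.exp 1 ≤ ((d + 1 : ℕ) : ℝ)) :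
    estimatedWidth G θhat u t ≤ 2 * γ + x ∧
    |approxGradient G θhat d S u t - θ.curvature u * Real.sinh (t - θ.field u)|
      ≤ (s + x) * Real.exp (2 * γ + x) + (2 * γ) ^ (d + 1) / (d + 1).factorial * 2 := by
  have hw : estimatedWidth G θhat u t ≤ 2 * γ + x := by
    unfold estimatedWidth
    have h1 : ∑ j ∈ Finset.univ.erase u, |restrictedCoupling G θhat u j|
        ≤ ∑ j ∈ Finset.univ.erase u, |restrictedCoupling G θhat u j - θ.coupling u j|
          + ∑ j ∈ Finset.univ.erase u, |θ.coupling u j| := by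
      rw [← Finset.sum_add_distrib]
      refine Finset.sum_le_sum fun j _ => ?_
      simpa using abs_add_le (restrictedCoupling G θhat u j - θ.coupling u j) (θ.coupling u j)
    have h2 := hwidth u
    have h3 := abs_nonneg (θ.field u)
    linarith
  refine ⟨hw, ?_⟩
  have hstat := abs_sum_multinomialCoeff_le G θhat d u t
    (f := fun K => S.read K - θ.mean (monomialValue K)) hs
    (fun K hK => by simp only [S.read_of_card_le hK]; exact hS ⟨K, hK⟩) hw
  simp only [mul_sub, Finset.sum_sub_distrib, sum_multinomialCoeff_mul_mean] at hstat
  have hexact := θ.mean_spin_mul_exp u (t - θ.field u)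
  -- The comparison passes through the truncated exponential at the true couplings: first the
  -- couplings change, then the truncation is removed.
  have hmean : |θ.mean (fun σ => spin (σ u) *
          expTrunc (d + 1) (-(spin (σ u) * estimatedField G θhat u t σ)))
        - θ.mean (fun σ => spin (σ u) *
          Real.exp (-(spin (σ u) * (θ.localField u σ + (t - θ.field u)))))|
      ≤ x * Real.exp (2 * γ + x) + (2 * γ) ^ (d + 1) / (d + 1).factorial * 2 := by
    rw [← IsingModel.mean_sub]
    refine θ.abs_mean_le fun σ => ?_
    rw [← mul_sub, abs_mul, abs_spin, one_mul]
    set a := estimatedField G θhat u t σ with ha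
    set b := θ.localField u σ + (t - θ.field u) with hb
    have hbab : b = t + ∑ j ∈ Finset.univ.erase u, θ.coupling u j * spin (σ j) := by
      rw [hb, IsingModel.localField]; ring
    have ha1 : |-(spin (σ u) * a)| ≤ 2 * γ + x := by
      rw [abs_neg, abs_mul, abs_spin, one_mul]
      exact (abs_estimatedField_le ..).trans hw
    have hb0 : |-(spin (σ u) * b)| ≤ 2 * γ := by
      rw [abs_neg, abs_mul, abs_spin, one_mul, hbab]
      refine (abs_add_le _ _).trans ?_
      have h1 : |∑ v ∈ Finset.univ.erase u, θ.coupling u v * spin (σ v)|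
          ≤ ∑ v ∈ Finset.univ.erase u, |θ.coupling u v| := by
        refine (Finset.abs_sum_le_sum_abs _ _).trans (le_of_eq ?_)
        simp [abs_mul, abs_spin]
      have h2 := hwidth u
      have h3 := abs_nonneg (θ.field u)
      linarith
    have hab : |-(spin (σ u) * a) - -(spin (σ u) * b)| ≤ x := by
      rw [neg_sub_neg, ← mul_sub, abs_mul, abs_spin, one_mul, hbab, ha, estimatedField,
        add_sub_add_left_eq_sub, ← Finset.sum_sub_distrib]
      refine (Finset.abs_sum_le_sum_abs _ _).trans (le_trans (le_of_eq ?_) hcoupling)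
      refine Finset.sum_congr rfl fun j _ => ?_
      rw [← sub_mul, abs_mul, abs_spin, mul_one, abs_sub_comm]
    -- Truncation is estimated only at the field with true couplings, of size at most `2γ`, so the
    -- degree need not depend on `x`.
    have hT : |Real.exp (-(spin (σ u) * b)) - expTrunc (d + 1) (-(spin (σ u) * b))|
        ≤ (2 * γ) ^ (d + 1) / (d + 1).factorial * 2 := by
      refine (abs_exp_sub_expTrunc_le ?_).trans (by gcongr)
      rw [div_le_iff₀ (by positivity)]
      have h2 : (2 : ℝ) ≤ Real.exp 1 := by linarith [Real.add_one_le_exp (1 : ℝ)]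
      nlinarith [mul_le_mul_of_nonneg_left h2 (by positivity : (0 : ℝ) ≤ 2 * γ)]
    have hD := abs_expTrunc_sub_expTrunc_le (d + 1) ha1 (hb0.trans (by linarith))
    have hD' : |expTrunc (d + 1) (-(spin (σ u) * a)) - expTrunc (d + 1) (-(spin (σ u) * b))|
        ≤ x * Real.exp (2 * γ + x) := hD.trans (by gcongr)
    rw [abs_le] at *
    constructor <;> linarith [hT.1, hT.2, hD'.1, hD'.2]
  rw [hexact] at hmean
  unfold approxGradient
  rw [abs_le] at *
  constructor <;> linarith [hstat.1, hstat.2, hmean.1, hmean.2]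

end Gradient

/-! ### Projected gradient descent -/

theorem abs_clip_le {γ : ℝ} (hγ : 0 ≤ γ) (x : ℝ) : |clip γ x| ≤ γ := by
  rw [abs_le]
  exact ⟨le_max_left _ _, max_le (by linarith) (min_le_left _ _)⟩

theorem abs_clip_sub_le {γ : ℝ} {y : ℝ} (hy : |y| ≤ γ) (x : ℝ) : |clip γ x - y| ≤ |x - y| := by
  obtain ⟨h1, h2⟩ := abs_le.1 hy
  unfold clip
  rcases le_total γ x with h | h
  · rw [min_eq_left h, max_eq_right (by linarith), abs_of_nonneg (by linarith),
      abs_of_nonneg (by linarith)]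
    linarith
  · rw [min_eq_right h]
    rcases le_total x (-γ) with h' | h'
    · rw [max_eq_left h', abs_of_nonpos (by linarith), abs_of_nonpos (by linarith)]
      linarith
    · rw [max_eq_right h']

/-- The regret bound for projected gradient descent started at `0`. -/
theorem sum_mul_sub_le_of_clip_step {γ η C y : ℝ} (hη : 0 < η) (hy : |y| ≤ γ) {z g : ℕ → ℝ}
    (hz0 : z 0 = 0) (hz : ∀ i, z (i + 1) = clip γ (z i - η * g i)) (hg : ∀ i, g i ^ 2 ≤ C) (T : ℕ) :
    ∑ i ∈ Finset.range T, g i * (z i - y) ≤ γ ^ 2 / (2 * η) + T * (η * C / 2) := by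
  have step : ∀ i, g i * (z i - y)
      ≤ ((z i - y) ^ 2 - (z (i + 1) - y) ^ 2) / (2 * η) + η * C / 2 := by
    intro i
    have h1 : (z (i + 1) - y) ^ 2 ≤ (z i - η * g i - y) ^ 2 := by
      rw [hz]
      exact sq_le_sq.2 (abs_clip_sub_le hy _)
    rw [div_add' _ _ _ (by positivity), le_div_iff₀ (by positivity)]
    nlinarith [mul_le_mul_of_nonneg_left (hg i) (sq_nonneg η)]
  have htel : ∑ i ∈ Finset.range T, ((z i - y) ^ 2 - (z (i + 1) - y) ^ 2)
      = (z 0 - y) ^ 2 - (z T - y) ^ 2 := Finset.sum_range_sub' (fun i => (z i - y) ^ 2) T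
  refine (Finset.sum_le_sum fun i _ => step i).trans ?_
  rw [Finset.sum_add_distrib, ← Finset.sum_div, htel, hz0]
  simp only [Finset.sum_const, Finset.card_range, nsmul_eq_mul]
  gcongr
  -- Starting at `0`, the midpoint of the interval, costs `γ ^ 2` instead of the squared diameter
  -- `4γ ^ 2`.
  have : y ^ 2 ≤ γ ^ 2 := sq_le_sq' (abs_le.1 hy).1 (abs_le.1 hy).2
  nlinarith [sq_nonneg (z T - y)]

theorem abs_average_le_sqrt {T : ℕ} (hT : 0 < T) {a : ℕ → ℝ} {b : ℝ}
    (h : ∑ i ∈ Finset.range T, a i ^ 2 ≤ T * b) :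
    |1 / (T : ℝ) * ∑ i ∈ Finset.range T, a i| ≤ Real.sqrt b := by
  have hT' : (0 : ℝ) < T := by exact_mod_cast hT
  refine Real.abs_le_sqrt ?_
  have hcs := sq_sum_le_card_mul_sum_sq (s := Finset.range T) (f := a)
  rw [Finset.card_range] at hcs
  rw [mul_pow, div_pow, one_pow, one_div_mul_eq_div, div_le_iff₀ (by positivity)]
  nlinarith [mul_le_mul_of_nonneg_left h hT'.le]

/-- Plays the role of strong convexity of the loss. -/
theorem sq_le_mul_sinh (x : ℝ) : x ^ 2 ≤ x * Real.sinh x := by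
  rcases le_total 0 x with h | h
  · have := Real.self_le_sinh_iff.2 h
    nlinarith
  · have := Real.sinh_le_self_iff.2 h
    nlinarith

/-- Projected gradient descent with an inexact gradient `c * sinh (z - y) + error`. -/
theorem sum_sq_sub_le_of_clip_step {γ η C y c e κ : ℝ} (hη : 0 < η) (hy : |y| ≤ γ)
    (hc : 0 ≤ c) (hκ : 0 ≤ κ) (hcκ : 1 ≤ κ * c) {z g : ℕ → ℝ}
    (hz0 : z 0 = 0) (hz : ∀ i, z (i + 1) = clip γ (z i - η * g i)) (hzγ : ∀ i, |z i| ≤ γ)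
    (hg : ∀ i, g i ^ 2 ≤ C) (he : ∀ i, |g i - c * Real.sinh (z i - y)| ≤ e) (T : ℕ) :
    ∑ i ∈ Finset.range T, (z i - y) ^ 2
      ≤ κ * (γ ^ 2 / (2 * η) + T * (η * C / 2 + 2 * γ * e)) := by
  have hreg := sum_mul_sub_le_of_clip_step hη hy hz0 hz hg T
  have hstep : ∀ i, (z i - y) ^ 2 ≤ κ * (g i * (z i - y) + 2 * γ * e) := by
    intro i
    have he0 : 0 ≤ e := (abs_nonneg _).trans (he i)
    have h1 : |z i - y| ≤ 2 * γ := by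
      refine (abs_sub _ _).trans ?_
      linarith [hzγ i]
    have h2 : |(g i - c * Real.sinh (z i - y)) * (z i - y)| ≤ 2 * γ * e := by
      rw [abs_mul, mul_comm]
      exact mul_le_mul h1 (he i) (abs_nonneg _) ((abs_nonneg _).trans h1)
    have h3 := (abs_le.1 h2).1
    have h4 := mul_le_mul_of_nonneg_left (sq_le_mul_sinh (z i - y)) hc
    calc (z i - y) ^ 2 ≤ κ * c * (z i - y) ^ 2 := le_mul_of_one_le_left (sq_nonneg _) hcκ
      _ = κ * (c * (z i - y) ^ 2) := by ring
      _ ≤ κ * (g i * (z i - y) + 2 * γ * e) := by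
        gcongr
        linarith
  refine (Finset.sum_le_sum fun i _ => hstep i).trans ?_
  rw [← Finset.mul_sum, Finset.sum_add_distrib]
  simp only [Finset.sum_const, Finset.card_range, nsmul_eq_mul]
  refine mul_le_mul_of_nonneg_left ?_ hκ
  linarith

section Iterates

variable {p : ℕ} (G : SimpleGraph (Fin p)) [DecidableRel G.Adj] (θhat : Fin p → Fin p → ℝ)
  (d : ℕ) (S : StatTable p (momentOrder d)) {γ : ℝ} (η : ℝ) (u : Fin p)

theorem abs_fieldIterate_le (hγ : 0 ≤ γ) (i : ℕ) : |fieldIterate G θhat d S γ η u i| ≤ γ := by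
  cases i with
  | zero => simpa [fieldIterate] using hγ
  | succ i => exact abs_clip_le hγ _

theorem abs_fieldEstimate_le (hγ : 0 ≤ γ) (T : ℕ) :
    |fieldEstimate G θhat d S γ η T u| ≤ γ := by
  unfold fieldEstimate
  rcases Nat.eq_zero_or_pos T with rfl | hT
  · simpa using hγ
  have hT' : (0 : ℝ) < T := by exact_mod_cast hT
  rw [abs_mul, abs_of_pos (by positivity : 0 < 1 / (T : ℝ)), one_div_mul_eq_div, div_le_iff₀ hT']
  refine (Finset.abs_sum_le_sum_abs _ _).trans
    ((Finset.sum_le_sum fun i _ => abs_fieldIterate_le G θhat d S η u hγ i).trans ?_)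
  simp [mul_comm]

theorem fieldEstimate_sub {T : ℕ} (hT : 0 < T) (y : ℝ) :
    fieldEstimate G θhat d S γ η T u - y
      = 1 / (T : ℝ) * ∑ i ∈ Finset.range T, (fieldIterate G θhat d S γ η u i - y) := by
  have hT' : (T : ℝ) ≠ 0 := by exact_mod_cast hT.ne'
  unfold fieldEstimate
  rw [Finset.sum_sub_distrib]
  simp only [Finset.sum_const, Finset.card_range, nsmul_eq_mul]
  field_simp

end Iterates

/-! ### Concentration of the statistics -/

/-- **Hoeffding's inequality** for the empirical mean of bounded independent variables with a
common expectation, two-sided. -/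
theorem measureReal_abs_average_sub_ge_le {Ω : Type*} [MeasurableSpace Ω] {P : Measure Ω}
    [IsProbabilityMeasure P] {n : ℕ} (hn : 0 < n) {Y : Fin n → Ω → ℝ} (hindep : iIndepFun Y P)
    (hmeas : ∀ i, AEMeasurable (Y i) P) (hbound : ∀ i ω, |Y i ω| ≤ 1) {a : ℝ}
    (hmean : ∀ i, ∫ ω, Y i ω ∂P = a) {s : ℝ} (hs : 0 ≤ s) :
    P.real {ω | s ≤ |1 / (n : ℝ) * ∑ i, Y i ω - a|} ≤ 2 * Real.exp (-(n * s ^ 2 / 2)) := by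
  have hn' : (0 : ℝ) < n := by exact_mod_cast hn
  have one_sided : ∀ {Z : Fin n → Ω → ℝ} {b : ℝ}, iIndepFun Z P → (∀ i, AEMeasurable (Z i) P) →
      (∀ i ω, |Z i ω| ≤ 1) → (∀ i, ∫ ω, Z i ω ∂P = b) →
      P.real {ω | n * s ≤ ∑ i, (Z i ω - b)} ≤ Real.exp (-(n * s ^ 2 / 2)) := by
    intro Z b hZ hZm hZb hZi
    -- The parameter `1` is the square of half the length of `[-1, 1]`.
    have hsub : ∀ i ∈ Finset.univ, HasSubgaussianMGF (fun ω => Z i ω - b) 1 P := by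
      intro i _
      have := hasSubgaussianMGF_of_mem_Icc (a := -1) (b := 1) (hZm i)
        (Filter.Eventually.of_forall fun ω => abs_le.1 (hZb i ω))
      rw [hZi i] at this
      convert this using 1
      ext
      norm_num
    have hind : iIndepFun (fun i ω => Z i ω - b) P :=
      hZ.comp (fun _ x => x - b) fun _ => measurable_id.sub_const b
    have := HasSubgaussianMGF.measure_sum_ge_le_of_iIndepFun hind hsub
      (by positivity : 0 ≤ (n : ℝ) * s)
    refine this.trans (le_of_eq ?_)
    congr 1
    simp
    field_simp
  have hup := one_sided hindep hmeas hbound hmean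
  have hdown := one_sided (Z := fun i ω => -Y i ω) (b := -a)
    (hindep.comp (fun _ x => -x) fun _ => measurable_neg) (fun i => (hmeas i).neg)
    (fun i ω => by simpa using hbound i ω) (fun i => by rw [integral_neg, hmean i])
  have hsubset : {ω | s ≤ |1 / (n : ℝ) * ∑ i, Y i ω - a|}
      ⊆ {ω | n * s ≤ ∑ i, (Y i ω - a)} ∪ {ω | n * s ≤ ∑ i, (-Y i ω - -a)} := by
    intro ω hω
    have e : 1 / (n : ℝ) * ∑ i, Y i ω - a = (∑ i, (Y i ω - a)) / n := by
      rw [Finset.sum_sub_distrib]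
      simp
      field_simp
    have e2 : ∑ i, (-Y i ω - -a) = -∑ i, (Y i ω - a) := by
      rw [← Finset.sum_neg_distrib]
      exact Finset.sum_congr rfl fun i _ => by ring
    rw [Set.mem_ofPred_eq, e, abs_div, abs_of_pos hn', le_div_iff₀ hn', mul_comm] at hω
    rw [Set.mem_union, Set.mem_ofPred_eq, Set.mem_ofPred_eq, e2]
    exact le_abs.1 hω
  calc P.real {ω | s ≤ |1 / (n : ℝ) * ∑ i, Y i ω - a|}
      ≤ P.real ({ω | n * s ≤ ∑ i, (Y i ω - a)} ∪ {ω | n * s ≤ ∑ i, (-Y i ω - -a)}) :=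
        measureReal_mono hsubset
    _ ≤ _ := measureReal_union_le _ _
    _ ≤ 2 * Real.exp (-(n * s ^ 2 / 2)) := by linarith

/-- The number of sets of at most `d + 1` elements, up to a factor `d + 1`. -/
theorem card_finset_card_le {p r d : ℕ} (hp : 1 ≤ p) (hr : r ≤ d + 1) :
    (Fintype.card {K : Finset (Fin p) // K.card ≤ r} : ℝ)
      ≤ (d + 1) * (Real.exp 1 * p) ^ (d + 1) := by
  have hcard : Fintype.card {K : Finset (Fin p) // K.card ≤ r}
      ≤ ∑ k ∈ Finset.range (d + 2), p.choose k := by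
    rw [Fintype.card_subtype]
    have hsub : (Finset.univ.filter fun K : Finset (Fin p) => K.card ≤ r)
        ⊆ (Finset.range (d + 2)).biUnion fun k => Finset.powersetCard k Finset.univ := by
      intro K hK
      have := (Finset.mem_filter.1 hK).2
      rw [Finset.mem_biUnion]
      exact ⟨K.card, Finset.mem_range.2 (by omega),
        Finset.mem_powersetCard.2 ⟨Finset.subset_univ _, rfl⟩⟩
    refine (Finset.card_le_card hsub).trans (Finset.card_biUnion_le.trans (le_of_eq ?_))
    simp
  have hp' : (1 : ℝ) ≤ p := by exact_mod_cast hp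
  have hterm : ∀ k ∈ Finset.range (d + 2),
      ((p.choose k : ℕ) : ℝ) ≤ (p : ℝ) ^ (d + 1) * ((1 : ℝ) ^ k / k.factorial) := by
    intro k hk
    -- `choose p k ≤ p ^ k / k!` with `p ^ k ≤ p ^ (d + 1)`; the sum over `k` of `1 / k!` then costs
    -- only a factor `e`.
    rw [one_pow, mul_one_div]
    refine (Nat.choose_le_pow_div k p).trans ?_
    have hkd : k ≤ d + 1 := Nat.lt_succ_iff.1 (Finset.mem_range.1 hk)
    gcongr
  have he : (1 : ℝ) ≤ Real.exp 1 := Real.one_le_exp zero_le_one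
  calc (Fintype.card {K : Finset (Fin p) // K.card ≤ r} : ℝ)
      ≤ ((∑ k ∈ Finset.range (d + 2), p.choose k : ℕ) : ℝ) := by exact_mod_cast hcard
    _ ≤ (p : ℝ) ^ (d + 1) * expTrunc (d + 2) 1 := by
      push_cast
      rw [expTrunc, Finset.mul_sum]
      exact Finset.sum_le_sum hterm
    _ ≤ (p : ℝ) ^ (d + 1) * Real.exp 1 := by
      gcongr
      exact expTrunc_le_exp _ zero_le_one
    _ ≤ (d + 1) * (Real.exp 1 * p) ^ (d + 1) := by
      rw [mul_pow, mul_comm]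
      have h1 : Real.exp 1 ≤ Real.exp 1 ^ (d + 1) := le_self_pow₀ he (by omega)
      have h2 : (1 : ℝ) ≤ d + 1 := by simp
      calc Real.exp 1 * (p : ℝ) ^ (d + 1) ≤ Real.exp 1 ^ (d + 1) * (p : ℝ) ^ (d + 1) := by gcongr
        _ ≤ _ := le_mul_of_one_le_left (by positivity) h2

theorem abs_empiricalStats_le {p r n : ℕ}
    (x : {K : Finset (Fin p) // K.card ≤ r} → Fin n → Config p) (K) :
    |empiricalStats x K| ≤ 1 := by
  unfold empiricalStats
  rw [abs_mul, abs_of_nonneg (by positivity), one_div_mul_eq_div]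
  refine div_le_one_of_le₀ ?_ (by positivity)
  refine (Finset.abs_sum_le_sum_abs _ _).trans ?_
  simp [abs_monomialValue]

/-- All statistics of order at most `d + 1` are simultaneously accurate. -/
theorem measureReal_forall_empiricalStats_ge {p d r n : ℕ} (hp : 1 ≤ p) (hr : r ≤ d + 1)
    (hn : 0 < n) (θ : IsingModel p) {Ω : Type*} [MeasurableSpace Ω] (P : Measure Ω)
    [IsProbabilityMeasure P] (X : {K : Finset (Fin p) // K.card ≤ r} → Fin n → Ω → Config p)
    (hindep : ∀ K, iIndepFun (X K) P) (hlaw : ∀ K i, HasLaw (X K i) θ.gibbs P)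
    {s δ : ℝ} (hs : 0 ≤ s) (hδ : 0 < δ)
    (hns : (d + 1) * Real.log (Real.exp 1 * p) + Real.log (2 * (d + 1) / δ) ≤ n * s ^ 2 / 2) :
    1 - δ ≤ P.real {ω | ∀ K, |empiricalStats (fun K i => X K i ω) K
      - θ.mean (monomialValue K.1)| ≤ s} := by
  set A := {ω | ∀ K, |empiricalStats (fun K i => X K i ω) K - θ.mean (monomialValue K.1)| ≤ s}
  set Bad : {K : Finset (Fin p) // K.card ≤ r} → Set Ω := fun K =>
    {ω | s ≤ |empiricalStats (fun K i => X K i ω) K - θ.mean (monomialValue K.1)|}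
  have hBad : ∀ K, P.real (Bad K) ≤ 2 * Real.exp (-(n * s ^ 2 / 2)) := by
    intro K
    have hm : Measurable (monomialValue K.1 : Config p → ℝ) := measurable_of_finite _
    refine measureReal_abs_average_sub_ge_le hn (Y := fun i ω => monomialValue K.1 (X K i ω))
      ((hindep K).comp (fun _ => monomialValue K.1) fun _ => hm)
      (fun i => hm.comp_aemeasurable (hlaw K i).aemeasurable)
      (fun i ω => (abs_monomialValue _ _).le) (fun i => ?_) hs
    rw [← IsingModel.integral_gibbs, ← (hlaw K i).integral_comp hm.aestronglyMeasurable]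
    rfl
  -- Covering the whole space and using subadditivity avoids complements, hence any measurability of
  -- `A`.
  have hcover : Set.univ ⊆ A ∪ ⋃ K, Bad K := by
    intro ω _
    by_cases h : ω ∈ A
    · exact Or.inl h
    · right
      simp only [A, Set.mem_ofPred_eq, not_forall, not_le] at h
      obtain ⟨K, hK⟩ := h
      exact Set.mem_iUnion.2 ⟨K, hK.le⟩
  have hp0 : (0 : ℝ) < p := by exact_mod_cast hp
  have hsum : P.real (⋃ K, Bad K) ≤ δ := by
    refine (measureReal_iUnion_fintype_le _).trans ((Finset.sum_le_sum fun K _ => hBad K).trans ?_)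
    rw [Finset.sum_const, Finset.card_univ, nsmul_eq_mul]
    have hexp : Real.exp (-(n * s ^ 2 / 2))
        ≤ ((Real.exp 1 * p) ^ (d + 1))⁻¹ * (2 * (d + 1) / δ)⁻¹ := by
      have : (Real.exp 1 * (p : ℝ)) ^ (d + 1) * (2 * (d + 1) / δ)
          = Real.exp ((d + 1) * Real.log (Real.exp 1 * p) + Real.log (2 * (d + 1) / δ)) := by
        rw [Real.exp_add, Real.exp_log (by positivity), mul_comm ((d : ℝ) + 1), Real.exp_mul,
          Real.exp_log (by positivity)]
        norm_cast
      rw [← mul_inv, this, ← Real.exp_neg]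
      exact Real.exp_le_exp.2 (neg_le_neg hns)
    calc (Fintype.card {K : Finset (Fin p) // K.card ≤ r} : ℝ)
          * (2 * Real.exp (-(n * s ^ 2 / 2)))
        ≤ ((d + 1) * (Real.exp 1 * p) ^ (d + 1))
          * (2 * (((Real.exp 1 * p) ^ (d + 1))⁻¹ * (2 * (d + 1) / δ)⁻¹)) := by
          gcongr
          exact card_finset_card_le hp hr
      _ = δ := by
        have : (Real.exp 1 * (p : ℝ)) ^ (d + 1) ≠ 0 := by positivity
        field_simp
  have h1 : (1 : ℝ) ≤ P.real A + P.real (⋃ K, Bad K) := by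
    calc (1 : ℝ) = P.real Set.univ := by simp
      _ ≤ P.real (A ∪ ⋃ K, Bad K) := measureReal_mono hcover
      _ ≤ _ := measureReal_union_le _ _
  linarith

/-! ### Learning the magnetic fields -/

/-- Off the edges both couplings vanish, so only the at most `D` neighbours contribute. -/
theorem sum_abs_restrictedCoupling_sub_le {p : ℕ} (θ : IsingModel p) {D : ℕ}
    (hD : θ.graph.maxDegree ≤ D) {εc : ℝ} (hεc : 0 ≤ εc) {θhat : Fin p → Fin p → ℝ}
    (hθhat : ∀ u v, θ.graph.Adj u v → |θhat u v - θ.coupling u v| ≤ εc) (u : Fin p) :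
    ∑ j ∈ Finset.univ.erase u, |restrictedCoupling θ.graph θhat u j - θ.coupling u j|
      ≤ D * εc := by
  have h1 : ∀ j ∈ Finset.univ.erase u,
      |restrictedCoupling θ.graph θhat u j - θ.coupling u j|
        ≤ if θ.graph.Adj u j then εc else 0 := by
    intro j hj
    unfold restrictedCoupling
    split_ifs with h
    · exact hθhat u j h
    · have : θ.coupling u j = 0 := by
        by_contra hne
        exact h ⟨(Finset.ne_of_mem_erase hj).symm, hne⟩
      simp [this]
  calc _ ≤ ∑ j ∈ Finset.univ.erase u, (if θ.graph.Adj u j then εc else 0) :=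
        Finset.sum_le_sum h1
    _ ≤ ∑ j, (if θ.graph.Adj u j then εc else 0) :=
        Finset.sum_le_sum_of_subset_of_nonneg (Finset.subset_univ _)
          fun j _ _ => by split_ifs <;> simp [hεc]
    _ = θ.graph.degree u * εc := by
        rw [← Finset.sum_filter, Finset.sum_const, nsmul_eq_mul,
          ← SimpleGraph.card_neighborFinset_eq_degree, SimpleGraph.neighborFinset_eq_filter]
    _ ≤ D * εc := by
        gcongr
        exact (θ.graph.degree_le_maxDegree u).trans hD

theorem exp_le_one_add_two_mul {x : ℝ} (hx : 0 ≤ x) (hx' : x ≤ 1 / 8) :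
    Real.exp x ≤ 1 + 2 * x := by
  have h := Real.add_one_le_exp (-x)
  rw [Real.exp_neg] at h
  have he := Real.exp_pos x
  -- It remains that `(1 - x) * (1 + 2 * x) ≥ 1` for small `x ≥ 0`.
  have h2 : (1 - x) * Real.exp x ≤ 1 := by
    have := mul_le_mul_of_nonneg_right h he.le
    rw [inv_mul_cancel₀ he.ne'] at this
    linarith
  nlinarith

/-- If the error bound is below the trivial one, the couplings are accurate. -/
theorem le_one_div_eight_of_mul_lt {γ x : ℝ} (hγ : 0 < γ) (hx : 0 ≤ x)
    (h : 8 * γ * (1 + γ) * Real.exp (3 * γ) * x < 4 * γ ^ 2) : x ≤ 1 / 8 := by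
  have h1 := Real.add_one_le_exp (3 * γ)
  have h2 : 8 * γ * (1 + γ) * (3 * γ + 1) * x ≤ 8 * γ * (1 + γ) * Real.exp (3 * γ) * x := by
    gcongr
  have h3 : 8 * γ * (4 * γ) * x ≤ 8 * γ * (1 + γ) * (3 * γ + 1) * x := by
    have : 4 * γ ≤ (1 + γ) * (3 * γ + 1) := by nlinarith [sq_nonneg γ]
    calc 8 * γ * (4 * γ) * x ≤ 8 * γ * ((1 + γ) * (3 * γ + 1)) * x := by gcongr
      _ = _ := by ring
  have hγ2 : 0 < γ ^ 2 := by positivity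
  by_contra hcon
  nlinarith [mul_lt_mul_of_pos_left (not_le.1 hcon) hγ2]

/-- The chosen degree makes the truncation error at most `ε / (4 * γ)`. -/
theorem truncation_error_le {γ εh : ℝ} (hγ : 0 < γ) (hεh : 0 < εh) (hlt : εh < 2 * γ) {d : ℕ}
    (hd : d = ⌈(γ + Real.log (8 * γ * (1 + γ) / εh ^ 2)) /
        lambertW (1 / (2 * Real.exp 1)
          + 1 / (2 * γ * Real.exp 1) * Real.log (8 * γ * (1 + γ) / εh ^ 2))⌉₊ - 1) :
    2 * γ * Real.exp 1 ≤ ((d + 1 : ℕ) : ℝ) ∧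
    (2 * γ) ^ (d + 1) / (d + 1).factorial * 2
      ≤ εh ^ 2 * Real.exp (-γ) / (2 * (1 + γ)) / (4 * γ) := by
  have hA : 0 < Real.log (8 * γ * (1 + γ) / εh ^ 2) := by
    refine Real.log_pos ?_
    rw [one_lt_div (by positivity)]
    nlinarith
  have harg : 1 / (2 * Real.exp 1)
      + 1 / (2 * γ * Real.exp 1) * Real.log (8 * γ * (1 + γ) / εh ^ 2)
      = (γ + Real.log (8 * γ * (1 + γ) / εh ^ 2)) / (2 * γ * Real.exp 1) := by
    field_simp
  rw [harg] at hd
  have hn : (γ + Real.log (8 * γ * (1 + γ) / εh ^ 2)) /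
      lambertW ((γ + Real.log (8 * γ * (1 + γ) / εh ^ 2)) / (2 * γ * Real.exp 1))
      ≤ ((d + 1 : ℕ) : ℝ) := by
    refine (Nat.le_ceil _).trans ?_
    exact_mod_cast (by omega)
  obtain ⟨h1, h2⟩ := pow_div_factorial_le_of_lambertW (by positivity : 0 < 2 * γ)
    (by positivity) (Nat.succ_le_succ (Nat.zero_le d)) hn
  refine ⟨h1, h2.trans (le_of_eq ?_)⟩
  rw [neg_add, Real.exp_add, Real.exp_neg (Real.log _), Real.exp_log (by positivity)]
  field_simp
  ring

/-- The number of observations is large enough for statistics of accuracy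
`ε * exp (-2 * γ) / (2 * γ)`. -/
theorem log_le_sample_size_mul {γ εh ε ℓ : ℝ} (hγ : 0 < γ) (hεh : 0 < εh) (hℓ : 0 < ℓ)
    (hε : ε = εh ^ 2 * Real.exp (-γ) / (2 * (1 + γ))) {n : ℕ}
    (hn : n = ⌈32 * γ ^ 2 * (1 + γ) ^ 2 * Real.exp (6 * γ) * (ℓ / εh ^ 4)⌉₊) :
    0 < n ∧ ℓ ≤ n * (ε * Real.exp (-(2 * γ)) / (2 * γ)) ^ 2 / 2 := by
  refine ⟨by rw [hn]; exact Nat.ceil_pos.2 (by positivity), ?_⟩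
  have h := Nat.le_ceil (32 * γ ^ 2 * (1 + γ) ^ 2 * Real.exp (6 * γ) * (ℓ / εh ^ 4))
  rw [← hn] at h
  have he : Real.exp (6 * γ) = Real.exp γ ^ 6 := by rw [← Real.exp_nat_mul]; norm_num
  have he2 : Real.exp (2 * γ) = Real.exp γ ^ 2 := by rw [← Real.exp_nat_mul]; norm_num
  -- The accuracy equals `εh ^ 2 * exp (-3γ) / (4γ(1 + γ))`; half its square cancels the constants
  -- of `n` exactly.
  calc ℓ = 32 * γ ^ 2 * (1 + γ) ^ 2 * Real.exp (6 * γ) * (ℓ / εh ^ 4)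
        * (ε * Real.exp (-(2 * γ)) / (2 * γ)) ^ 2 / 2 := by
        rw [hε, Real.exp_neg, Real.exp_neg, he, he2]
        field_simp
        ring
    _ ≤ _ := by gcongr

/-- The regret of projected gradient descent with the chosen step size and number of steps. -/
theorem regret_le {γ L ε η T : ℝ} (hγ : 0 < γ) (hL : 0 < L) (hε : 0 < ε) (hT : 0 < T)
    (hη : η = 2 * γ / (L * Real.sqrt T)) (hsqrt : 4 * γ * L / ε ≤ Real.sqrt T) :
    γ ^ 2 / (2 * η) + T * (η * (7 / 4 * L ^ 2) / 2) ≤ T * (ε / 2) := by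
  have hsq0 : 0 < Real.sqrt T := Real.sqrt_pos.2 hT
  have hsqT : Real.sqrt T * Real.sqrt T = T := Real.mul_self_sqrt hT.le
  rw [div_le_iff₀ hε] at hsqrt
  -- The two terms are `1/4` and `7/4` of `γ * L * √T`: starting at `0` leaves room for a squared
  -- gradient as large as `7/4 * L ^ 2`.
  calc γ ^ 2 / (2 * η) + T * (η * (7 / 4 * L ^ 2) / 2) = 2 * γ * L * Real.sqrt T := by
        rw [hη]
        field_simp
        linear_combination (-28 : ℝ) * hsqT
    _ = 4 * γ * L * (Real.sqrt T / 2) := by ring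
    _ ≤ Real.sqrt T * ε * (Real.sqrt T / 2) := by gcongr
    _ = T * (ε / 2) := by linear_combination (ε / 2) * hsqT

/-- The mean squared error of the iterates in terms of the target accuracy. -/
theorem cosh_mul_regret_le {γ εh ε x η C T : ℝ} (hγ : 0 < γ) (hε0 : 0 < ε) (hx0 : 0 ≤ x)
    (hε : ε = εh ^ 2 * Real.exp (-γ) / (2 * (1 + γ)))
    (hstep : γ ^ 2 / (2 * η) + T * (η * C / 2) ≤ T * (ε / 2)) (hT0 : 0 < T) :
    Real.cosh γ * (γ ^ 2 / (2 * η) + T * (η * C / 2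
        + 2 * γ * (ε / (2 * γ) + ε / (4 * γ) + 4 * x * Real.exp (2 * γ))))
      ≤ T * (εh ^ 2 + 8 * γ * (1 + γ) * Real.exp (3 * γ) * x) := by
  have hcosh : Real.cosh γ ≤ Real.exp γ := by
    rw [Real.cosh_eq]
    have : Real.exp (-γ) ≤ Real.exp γ := Real.exp_le_exp.2 (by linarith)
    linarith
  -- Sampling costs `ε`, truncation `ε / 2`, and the regret another `ε / 2`, hence `2 * ε` in all.
  have h1 : 2 * γ * (ε / (2 * γ) + ε / (4 * γ) + 4 * x * Real.exp (2 * γ))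
      = 3 / 2 * ε + 8 * γ * x * Real.exp (2 * γ) := by
    field_simp
    ring
  have h2 : Real.exp γ * (2 * ε) ≤ εh ^ 2 := by
    rw [hε, Real.exp_neg]
    rw [show Real.exp γ * (2 * (εh ^ 2 * (Real.exp γ)⁻¹ / (2 * (1 + γ)))) = εh ^ 2 / (1 + γ) by
      field_simp]
    exact div_le_self (by positivity) (by linarith)
  have h3 : Real.exp γ * Real.exp (2 * γ) = Real.exp (3 * γ) := by
    rw [← Real.exp_add]; congr 1; ring
  have h4 : 0 ≤ 8 * γ * γ * Real.exp (3 * γ) * x := by positivity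
  calc _ ≤ Real.cosh γ * (T * (2 * ε + 8 * γ * x * Real.exp (2 * γ))) := by
        refine mul_le_mul_of_nonneg_left ?_ (Real.cosh_pos γ).le
        rw [h1]
        linarith
    _ ≤ Real.exp γ * (T * (2 * ε + 8 * γ * x * Real.exp (2 * γ))) := by gcongr
    _ = T * (Real.exp γ * (2 * ε) + 8 * γ * x * (Real.exp γ * Real.exp (2 * γ))) := by ring
    _ ≤ T * (εh ^ 2 + 8 * γ * (1 + γ) * Real.exp (3 * γ) * x) := by
        rw [h3]
        refine mul_le_mul_of_nonneg_left ?_ hT0.le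
        linarith

/-- The accuracy required of the statistics is at most one. -/
theorem statistical_accuracy_le_one {γ εh ε : ℝ} (hγ : 0 < γ) (hεh : 0 < εh) (hlt : εh < 2 * γ)
    (hε : ε = εh ^ 2 * Real.exp (-γ) / (2 * (1 + γ))) :
    ε * Real.exp (-(2 * γ)) / (2 * γ) ≤ 1 := by
  have h1 : Real.exp (-γ) ≤ 1 := Real.exp_le_one_iff.2 (by linarith)
  have h2 : Real.exp (-(2 * γ)) ≤ 1 := Real.exp_le_one_iff.2 (by linarith)
  have h3 : ε ≤ 2 * γ := by
    rw [hε, div_le_iff₀ (by positivity)]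
    calc εh ^ 2 * Real.exp (-γ) ≤ (2 * γ) ^ 2 * 1 := by gcongr
      _ ≤ 2 * γ * (2 * (1 + γ)) := by nlinarith
  have h4 : 0 ≤ ε := by rw [hε]; positivity
  rw [div_le_one (by positivity)]
  exact (mul_le_of_le_one_right h4 h2).trans h3

theorem sqrt_sq_add_le {a b : ℝ} (ha : 0 ≤ a) (hb : 0 ≤ b) :
    Real.sqrt (a ^ 2 + b) ≤ a + Real.sqrt b := by
  refine Real.sqrt_le_iff.2 ⟨by positivity, ?_⟩
  nlinarith [Real.sq_sqrt hb, Real.sqrt_nonneg b]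

/-- With accurate statistics the algorithm recovers the field at every node. -/
theorem abs_fieldEstimate_sub_field_le {p : ℕ} (θ : IsingModel p)
    {γ : ℝ} (hγ : 0 < γ) (hwidth : θ.WidthLE γ) {D : ℕ} (hD : θ.graph.maxDegree ≤ D)
    {εc : ℝ} (hεc : 0 ≤ εc) {θhat : Fin p → Fin p → ℝ}
    (hθhat : ∀ u v, θ.graph.Adj u v → |θhat u v - θ.coupling u v| ≤ εc)
    {εh : ℝ} (hεh : 0 < εh) {ε L η : ℝ} {T d : ℕ}
    (hε : ε = εh ^ 2 * Real.exp (-γ) / (2 * (1 + γ)))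
    (hL : L = (1 + D * εc) * Real.exp (2 * γ) + ε / (4 * γ))
    (hT : T = ⌈16 * γ ^ 2 * L ^ 2 / ε ^ 2⌉₊)
    (hη : η = 2 * γ / (L * Real.sqrt T))
    (hd : d = ⌈(γ + Real.log (8 * γ * (1 + γ) / εh ^ 2)) /
        lambertW (1 / (2 * Real.exp 1)
          + 1 / (2 * γ * Real.exp 1) * Real.log (8 * γ * (1 + γ) / εh ^ 2))⌉₊ - 1)
    {S : StatTable p (momentOrder d)} (hS1 : ∀ K, |S K| ≤ 1)
    (hS : ∀ K, |S K - θ.mean (monomialValue K.1)| ≤ ε * Real.exp (-(2 * γ)) / (2 * γ))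
    (u : Fin p) :
    |fieldEstimate θ.graph θhat d S γ η T u - θ.field u|
      ≤ εh + Real.sqrt (8 * γ * (1 + γ) * Real.exp (3 * γ) * D * εc) := by
  have hfield : |θ.field u| ≤ γ :=
    le_trans (le_add_of_nonneg_left (Finset.sum_nonneg fun _ _ => abs_nonneg _)) (hwidth u)
  have htrivial : |fieldEstimate θ.graph θhat d S γ η T u - θ.field u| ≤ 2 * γ := by
    refine (abs_sub _ _).trans ?_
    linarith [abs_fieldEstimate_le θ.graph θhat d S η u hγ.le T]
  set x : ℝ := D * εc with hx
  have hx0 : 0 ≤ x := by positivity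
  rw [show 8 * γ * (1 + γ) * Real.exp (3 * γ) * D * εc
    = 8 * γ * (1 + γ) * Real.exp (3 * γ) * x by rw [hx]; ring]
  rcases le_or_gt (2 * γ) εh with hbig | hsmall
  · linarith [Real.sqrt_nonneg (8 * γ * (1 + γ) * Real.exp (3 * γ) * x)]
  rcases le_or_gt (4 * γ ^ 2) (8 * γ * (1 + γ) * Real.exp (3 * γ) * x) with hQ | hQ
  · have : 2 * γ ≤ Real.sqrt (8 * γ * (1 + γ) * Real.exp (3 * γ) * x) := by
      refine Real.le_sqrt_of_sq_le (le_trans (le_of_eq ?_) hQ)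
      ring
    linarith
  have hx8 : x ≤ 1 / 8 := le_one_div_eight_of_mul_lt hγ hx0 hQ
  have hε0 : 0 < ε := by rw [hε]; positivity
  have hLe : Real.exp (2 * γ) ≤ L := by
    rw [hL]
    have : 0 ≤ x * Real.exp (2 * γ) := by positivity
    have : 0 ≤ ε / (4 * γ) := by positivity
    linarith
  have hL0 : 0 < L := (Real.exp_pos _).trans_le hLe
  have hTpos : 0 < T := by rw [hT]; exact Nat.ceil_pos.2 (by positivity)
  have hT0 : (0 : ℝ) < T := by exact_mod_cast hTpos
  have hsq0 : 0 < Real.sqrt T := Real.sqrt_pos.2 hT0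
  have hη0 : 0 < η := by rw [hη]; positivity
  have hsqrt : 4 * γ * L / ε ≤ Real.sqrt T := by
    refine Real.le_sqrt_of_sq_le (le_trans (le_of_eq ?_) (hT ▸ Nat.le_ceil _))
    ring
  set s : ℝ := ε * Real.exp (-(2 * γ)) / (2 * γ) with hs
  have hs0 : 0 ≤ s := by positivity
  have hse : s * Real.exp (2 * γ) = ε / (2 * γ) := by
    rw [hs, Real.exp_neg]
    field_simp
  have hs1 : s ≤ 1 := statistical_accuracy_le_one hγ hεh hsmall hε
  obtain ⟨hdeg, htrunc⟩ := truncation_error_le hγ hεh hsmall hd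
  rw [← hε] at htrunc
  have hcoupling := sum_abs_restrictedCoupling_sub_le θ hD hεc hθhat u
  rw [← hx] at hcoupling
  have hexpx := exp_le_one_add_two_mul hx0 hx8
  have hz := fun i => abs_fieldIterate_le θ.graph θhat d S η u hγ.le i
  have hgrad := fun i => abs_approxGradient_sub_le θ hγ hwidth (hz i) hx0 hs0 hcoupling hS hdeg
  have hC : ∀ i, approxGradient θ.graph θhat d S u (fieldIterate θ.graph θhat d S γ η u i) ^ 2
      ≤ 7 / 4 * L ^ 2 := by
    intro i
    -- `exp x ≤ 1 + 2x ≤ 5/4`, and `(5/4) ^ 2 = 25/16 ≤ 7/4`.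
    have h1 : |approxGradient θ.graph θhat d S u (fieldIterate θ.graph θhat d S γ η u i)|
        ≤ L * (5 / 4) := by
      refine (abs_approxGradient_le _ _ _ _ _ hS1 (hgrad i).1).trans ?_
      rw [Real.exp_add]
      gcongr
      linarith
    have h2 := sq_le_sq' (abs_le.1 h1).1 (abs_le.1 h1).2
    have h3 := sq_nonneg L
    rw [mul_pow] at h2
    linarith
  have herr : ∀ i, |approxGradient θ.graph θhat d S u (fieldIterate θ.graph θhat d S γ η u i)
      - θ.curvature u * Real.sinh (fieldIterate θ.graph θhat d S γ η u i - θ.field u)|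
      ≤ ε / (2 * γ) + ε / (4 * γ) + 4 * x * Real.exp (2 * γ) := by
    intro i
    refine (hgrad i).2.trans ?_
    have h1 : (s + x) * Real.exp (2 * γ + x) ≤ ε / (2 * γ) + 4 * x * Real.exp (2 * γ) := by
      rw [Real.exp_add, ← hse]
      calc (s + x) * (Real.exp (2 * γ) * Real.exp x)
          ≤ (s + x) * (Real.exp (2 * γ) * (1 + 2 * x)) := by gcongr
        _ = s * Real.exp (2 * γ) + x * (2 * s + 1 + 2 * x) * Real.exp (2 * γ) := by ring
        -- From `s ≤ 1` and `x ≤ 1/8`, `2s + 1 + 2x ≤ 4`.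
        _ ≤ s * Real.exp (2 * γ) + x * 4 * Real.exp (2 * γ) := by
          gcongr
          linarith
        _ = _ := by ring
    linarith
  have hmain := sum_sq_sub_le_of_clip_step hη0 hfield (θ.curvature_pos u).le
    (Real.cosh_pos γ).le (θ.one_le_cosh_mul_curvature hγ.le hwidth u)
    (z := fieldIterate θ.graph θhat d S γ η u)
    (g := fun i => approxGradient θ.graph θhat d S u (fieldIterate θ.graph θhat d S γ η u i))
    rfl (fun _ => rfl) hz hC herr T
  have hbound := cosh_mul_regret_le hγ hε0 hx0 hε (regret_le hγ hL0 hε0 hT0 hη hsqrt) hT0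
  rw [fieldEstimate_sub _ _ _ _ _ _ hTpos]
  refine (abs_average_le_sqrt hTpos (hmain.trans hbound)).trans ?_
  exact sqrt_sq_add_le hεh.le (by positivity)

end

theorem theorem3 {p : ℕ} (θ : IsingModel p)
    (γ : ℝ) (hγ : 0 < γ) (hwidth : θ.WidthLE γ)
    (D : ℕ) (hD : θ.graph.maxDegree ≤ D)
    -- coupling estimates that are accurate on the edges
    (εc : ℝ) (hεc : 0 ≤ εc) (θhat : Fin p → Fin p → ℝ)
    (hθhat : ∀ u v, θ.graph.Adj u v → |θhat u v - θ.coupling u v| ≤ εc)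
    -- target accuracy and failure probability
    (εh : ℝ) (hεh : 0 < εh) (δ : ℝ) (hδ₀ : 0 < δ) (hδ₁ : δ < 1)
    -- the parameters of the algorithm
    (ε L η : ℝ) (T d n : ℕ)
    (hε : ε = εh ^ 2 * Real.exp (-γ) / (2 * (1 + γ)))
    (hL : L = (1 + D * εc) * Real.exp (2 * γ) + ε / (4 * γ))
    (hT : T = ⌈16 * γ ^ 2 * L ^ 2 / ε ^ 2⌉₊)
    (hη : η = 2 * γ / (L * Real.sqrt T))
    (hd : d = ⌈(γ + Real.log (8 * γ * (1 + γ) / εh ^ 2)) /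
        lambertW (1 / (2 * Real.exp 1)
          + 1 / (2 * γ * Real.exp 1) * Real.log (8 * γ * (1 + γ) / εh ^ 2))⌉₊ - 1)
    (hn : n = ⌈32 * γ ^ 2 * (1 + γ) ^ 2 * Real.exp (6 * γ) *
        (((d + 1) * Real.log (Real.exp 1 * p) + Real.log (2 * (d + 1) / δ)) / εh ^ 4)⌉₊)
    -- every statistic is computed from `n` independent observations of the model;
    -- nothing is assumed about the joint law of the observations behind different statistics
    {Ω : Type*} [MeasurableSpace Ω] (P : Measure Ω) [IsProbabilityMeasure P]
    (X : {K : Finset (Fin p) // K.card ≤ momentOrder d} → Fin n → Ω → Config p)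
    (hindep : ∀ K, iIndepFun (X K) P)
    (hlaw : ∀ K i, HasLaw (X K i) θ.gibbs P) :
    1 - δ ≤ P.real {ω | ∀ u : Fin p,
      |fieldEstimate θ.graph θhat d (empiricalStats (fun K i => X K i ω)) γ η T u - θ.field u|
        ≤ εh + Real.sqrt (8 * γ * (1 + γ) * Real.exp (3 * γ) * D * εc)} := by
  -- Without spins the claim is vacuous; otherwise `log (e * p) ≥ 0`, which makes `n` positive.
  rcases Nat.eq_zero_or_pos p with rfl | hp
  · have : {ω | ∀ u : Fin 0,
      |fieldEstimate θ.graph θhat d (empiricalStats (fun K i => X K i ω)) γ η T u - θ.field u|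
        ≤ εh + Real.sqrt (8 * γ * (1 + γ) * Real.exp (3 * γ) * D * εc)} = Set.univ :=
      Set.eq_univ_of_forall fun ω u => u.elim0
    rw [this, probReal_univ]
    linarith
  have hp' : (1 : ℝ) ≤ p := by exact_mod_cast hp
  have hℓ : 0 < ((d : ℝ) + 1) * Real.log (Real.exp 1 * p) + Real.log (2 * (d + 1) / δ) := by
    have h1 : 0 ≤ Real.log (Real.exp 1 * p) :=
      Real.log_nonneg (one_le_mul_of_one_le_of_one_le (Real.one_le_exp zero_le_one) hp')
    have h2 : 0 < Real.log (2 * ((d : ℝ) + 1) / δ) := by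
      refine Real.log_pos ?_
      rw [one_lt_div hδ₀]
      have : (0 : ℝ) ≤ d := Nat.cast_nonneg d
      linarith
    positivity
  obtain ⟨hn0, hns⟩ := log_le_sample_size_mul hγ hεh hℓ hε hn
  have hε0 : 0 < ε := by rw [hε]; positivity
  have hr : momentOrder d ≤ d + 1 := Nat.sub_le _ _
  refine (measureReal_forall_empiricalStats_ge hp hr hn0 θ P X hindep hlaw (by positivity) hδ₀
    hns).trans (measureReal_mono fun ω hω u => ?_)
  exact abs_fieldEstimate_sub_field_le θ hγ hwidth hD hεc hθhat hεh hε hL hT hη hd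
    (abs_empiricalStats_le _) hω u
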